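/- Let $F$ be a field with a valuation $v:F\to\Gamma\cup\{\infty\}$ ($\Gamma$ a totally ordered abelian group), let $\Gamma_v$ be its value group and $O_v$ its valuation ring, and let $E/F$ be a finite field extension. A quasi-valuation on $E$ is a map $w:E\to M\cup\{\infty\}$, $M$ a totally ordered abelian monoid (written additively, with $a\le b\Rightarrow a+c\le b+c$), such that $w(0)=\infty$, $w(xy)\ge w(x)+w(y)$ and $w(x+y)\ge\min\{w(x),w(y)\}$ for all $x,y\in E$; its value monoid $M_w$ is the submonoid of $M$ generated by $w(E\setminus\{0\})$. It extends $v$ if $w|_F=v$, where $\Gamma_v$ is identified with an ordered submonoid of $M$. It is exponential if $w(x^n)=n\,w(x)$ for all $x\in E$ and all integers $n\ge1$. Consider only quasi-valuations $w$ on $E$ that extend $v$ and whose value monoid is weakly cancellative (for $a,b\in M_w$, $a+b=a$ implies $b=0$), and put $O_w=\{x\in E: w(x)\ge0\}$. Two such quasi-valuations $w,w'$ are identified if there is an isomorphism of ordered monoids $M_w\to M_{w'}$ carrying $w$ to $w'$ (it then fixes $\Gamma_v$). A subring of $E$ is called an integrally closed quasi-valuation ring if it is of the form $O_w$ for some such $w$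 (not necessarily exponential) and is integrally closed in $E$. Then $w\mapsto O_w$ is a bijection from the set of exponential quasi-valuations extending $v$ (up to the above identification) onto the set of integrally closed quasi-valuation rings; in particular $O_w$ is integrally closed in $E$ for every exponential $w$. Moreover, for every integrally closed quasi-valuation ring $R$ there are finitely many valuations $u_1,\dots,u_k$ ($k\ge1$) on $E$ extending $v$, with values in the divisible hull $\Gamma_{\mathrm{div}}$ of $\Gamma$ (together with $\infty$), such that $$R=\bigcap_{i=1}^k O_{u_i},\qquad O_{u_i}=\{x\in E:u_i(x)\ge0\},$$ and $w(x)=\min_i u_i(x)$ is an exponential quasi-valuation extending $v$ with $O_w=R$; up to the above identification it is the only exponential quasi-valuation extending $v$ whose ring is $R$. -/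

import Mathlib

universe uF uE uΓ uM uN

/-- A quasi-valuation on a ring `R` with values in `M ∪ {∞}`, where `M` is a totally ordered
abelian monoid. -/
structure QuasiValuation (R : Type uE) [Ring R] (M : Type uM) [AddCommMonoid M] [LinearOrder M]
    [IsOrderedAddMonoid M] where
  toFun : R → WithTop M
  map_zero' : toFun 0 = ⊤
  map_mul' : ∀ x y, toFun x + toFun y ≤ toFun (x * y)
  map_add' : ∀ x y, min (toFun x) (toFun y) ≤ toFun (x + y)

/-- `M` is weakly cancellative: `a + b = a` implies `b = 0`. -/
def IsWeaklyCancellative (M : Type uM) [AddMonoid M] : Prop :=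
  ∀ a b : M, a + b = a → b = 0

/-- The value group `Γ_v` of a valuation `v : F → Γ ∪ {∞}` on a field: the set of values that `v`
takes on nonzero elements (those of value `≠ ∞`). -/
def valueGroup {F : Type uF} [Field F] {Γ : Type uΓ} [AddCommGroup Γ] [LinearOrder Γ]
    [IsOrderedAddMonoid Γ] (v : AddValuation F (WithTop Γ)) : AddSubgroup Γ where
  carrier := {γ | ∃ a : F, v a = (γ : WithTop Γ)}
  zero_mem' := ⟨1, by simp⟩
  add_mem' := by
    rintro γ δ ⟨a, ha⟩ ⟨b, hb⟩
    exact ⟨a * b, by rw [AddValuation.map_mul, ha, hb, WithTop.coe_add]⟩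
  neg_mem' := by
    rintro γ ⟨a, ha⟩
    exact ⟨a⁻¹, by rw [AddValuation.map_inv, ha]; rfl⟩

namespace QuasiValuation

section

variable {R : Type uE} [Ring R] {M : Type uM} [AddCommMonoid M] [LinearOrder M]
  [IsOrderedAddMonoid M] {N : Type uN} [AddCommMonoid N] [LinearOrder N] [IsOrderedAddMonoid N]

instance : CoeFun (QuasiValuation R M) (fun _ => R → WithTop M) := ⟨QuasiValuation.toFun⟩

/-- `w` is exponential: `w (x ^ n) = n w(x)` for all `x` and all positive integers `n`. -/
def IsExponential (w : QuasiValuation R M) : Prop :=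
  ∀ (x : R) (n : ℕ), 0 < n → w (x ^ n) = n • w x

/-- The value monoid `M_w`: the submonoid of `M` generated by the values of nonzero elements. -/
def valueMonoid (w : QuasiValuation R M) : AddSubmonoid M :=
  AddSubmonoid.closure {m | ∃ x : R, x ≠ 0 ∧ w x = (m : WithTop M)}

/-- Two quasi-valuations agree up to an isomorphism `M_w ≃ M_w'` of totally ordered monoids,
that is, `w = w'` once their value monoids have been identified. When both extend the same
valuation `v`, such an isomorphism automatically fixes the value group of `v`. -/
def Equivalent (w : QuasiValuation R M) (w' : QuasiValuation R N) : Prop :=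
  ∃ e : w.valueMonoid ≃+o w'.valueMonoid, ∀ (x : R) (m : w.valueMonoid),
    w x = ((m : M) : WithTop M) ↔ w' x = ((e m : N) : WithTop N)

end

section

variable {F : Type uF} [Field F] {E : Type uE} [Field E] [Algebra F E] {Γ : Type uΓ}
  [AddCommGroup Γ] [LinearOrder Γ] [IsOrderedAddMonoid Γ] {M : Type uM} [AddCommMonoid M]
  [LinearOrder M] [IsOrderedAddMonoid M]

/-- `w|_F = v`, where the value group of `v` is regarded as an ordered submonoid of `M`
through the embedding `ι` (determined by `v` and `w`). -/
def Extends (w : QuasiValuation E M) (v : AddValuation F (WithTop Γ)) : Prop :=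
  ∃ ι : valueGroup v →+ M, StrictMono ι ∧ ∀ (a : F) (γ : valueGroup v),
    v a = ((γ : Γ) : WithTop Γ) → w (algebraMap F E a) = (ι γ : WithTop M)

theorem Extends.map_one {w : QuasiValuation E M} {v : AddValuation F (WithTop Γ)}
    (h : w.Extends v) : w 1 = 0 := by
  obtain ⟨ι, -, h⟩ := h
  simpa using h 1 0 (by simp)

theorem Extends.map_neg_one {w : QuasiValuation E M} {v : AddValuation F (WithTop Γ)}
    (h : w.Extends v) : w (-1) = 0 := by
  obtain ⟨ι, -, h⟩ := h
  simpa using h (-1) 0 (by simp)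

/-- The quasi-valuation ring `O_w = {x ∈ E | w x ≥ 0}` of a quasi-valuation extending `v`. -/
def ring {v : AddValuation F (WithTop Γ)} (w : QuasiValuation E M) (h : w.Extends v) :
    Subring E where
  carrier := {x | 0 ≤ w x}
  mul_mem' := fun {x y} hx hy => (add_nonneg hx hy).trans (w.map_mul' x y)
  one_mem' := h.map_one.ge
  add_mem' := fun {x y} hx hy => (le_min hx hy).trans (w.map_add' x y)
  zero_mem' := by simp [w.map_zero']
  neg_mem' := fun {x} hx => by
    have := w.map_mul' (-1) x
    rw [h.map_neg_one, zero_add, neg_one_mul] at this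
    exact le_trans hx this

end

end QuasiValuation

section

variable {F : Type uF} [Field F] {Γ : Type uΓ} [AddCommGroup Γ] [LinearOrder Γ]
  [IsOrderedAddMonoid Γ]

/-- A quasi-valuation on `E` extending `v`, with values in some totally ordered abelian monoid
`M` and with weakly cancellative value monoid. -/
structure QuasiValuationExt (v : AddValuation F (WithTop Γ)) (E : Type uE) [Field E]
    [Algebra F E] where
  M : Type uΓ
  [addCommMonoid : AddCommMonoid M]
  [linearOrder : LinearOrder M]
  [isOrderedAddMonoid : IsOrderedAddMonoid M]
  w : QuasiValuation E M
  extends_v : w.Extends v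
  weaklyCancellative : IsWeaklyCancellative w.valueMonoid

attribute [instance] QuasiValuationExt.addCommMonoid QuasiValuationExt.linearOrder
  QuasiValuationExt.isOrderedAddMonoid

/-- An exponential quasi-valuation on `E` extending `v`. -/
structure ExpQuasiValuationExt (v : AddValuation F (WithTop Γ)) (E : Type uE) [Field E]
    [Algebra F E] extends QuasiValuationExt v E where
  exponential : w.IsExponential

variable (v : AddValuation F (WithTop Γ)) (E : Type uE) [Field E] [Algebra F E]

/-- The set of integrally closed quasi-valuation rings: the subrings of `E` of the form `O_w`, for
a (not necessarily exponential) quasi-valuation `w` extending `v`, that are integrally closed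
in `E`. -/
def integrallyClosedQuasiValuationRings : Set (Subring E) :=
  {R | IsIntegrallyClosedIn R E ∧ ∃ W : QuasiValuationExt v E, W.w.ring W.extends_v = R}

/-- Equality of exponential quasi-valuations extending `v`, up to identification of the
value monoids. -/
instance ExpQuasiValuationExt.setoid : Setoid (ExpQuasiValuationExt v E) where
  r W W' := W.w.Equivalent W'.w
  iseqv :=
    { refl := fun W => ⟨OrderAddMonoidIso.refl _, fun _ _ => Iff.rfl⟩
      symm := by
        rintro W W' ⟨e, he⟩
        refine ⟨e.symm, fun x m => ?_⟩
        simpa using (he x (e.symm m)).symm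
      trans := by
        rintro W W' W'' ⟨e, he⟩ ⟨e', he'⟩
        exact ⟨e.trans e', fun x m => (he x m).trans (he' x (e m))⟩ }

variable {E}

theorem QuasiValuation.Equivalent.nonneg {M : Type uM} [AddCommMonoid M]
    [LinearOrder M] [IsOrderedAddMonoid M] {N : Type uN} [AddCommMonoid N] [LinearOrder N]
    [IsOrderedAddMonoid N] {w : QuasiValuation E M} {w' : QuasiValuation E N}
    (h : w.Equivalent w') {x : E} (hx : 0 ≤ w x) : 0 ≤ w' x := by
  obtain ⟨e, he⟩ := h
  cases hq : w' x with
  | top => exact le_top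
  | coe n =>
    have hx0 : x ≠ 0 := by
      rintro rfl
      rw [w'.map_zero'] at hq
      exact WithTop.top_ne_coe hq
    have hn : n ∈ w'.valueMonoid := AddSubmonoid.subset_closure ⟨x, hx0, hq⟩
    have h1 := (he x (e.symm ⟨n, hn⟩)).2 (by simpa using hq)
    rw [h1] at hx
    have h2 : (0 : w.valueMonoid) ≤ e.symm ⟨n, hn⟩ := by exact_mod_cast hx
    have h3 : (0 : w'.valueMonoid) ≤ ⟨n, hn⟩ := by
      have := e.map_le_map_iff'.2 h2
      simpa using this
    exact_mod_cast h3

variable (E)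

/-- The map `w ↦ O_w` on the exponential quasi-valuations extending `v`. -/
def quasiValuationRingMap : Quotient (ExpQuasiValuationExt.setoid v E) → Subring E :=
  Quotient.lift (fun W => W.w.ring W.extends_v) (by
    intro W W' h
    ext x
    exact ⟨fun hx => h.nonneg hx, fun hx =>
      QuasiValuation.Equivalent.nonneg ((ExpQuasiValuationExt.setoid v E).symm h) hx⟩)

end

/-! The terms of the minimal polynomial of `x`, evaluated at `x`, sum to zero, so two of them have
equal value. Hence values on `E` are torsion over the value group of `v`, both for valuations and
for exponential quasi-valuations, where weak cancellation replaces division.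

Existence: weak cancellation puts the elements of `F` of positive value in the Jacobson radical of
`O_w`. If `O_w` is integrally closed, each `x` outside it is excluded by a valuation ring that
contains `O_w` and has that radical among its nonunits; such a ring lies over `v`. At most `[E : F]`
valuation rings lie over `v`, and each comes from a valuation into the divisible hull. So `O_w` is a
finite intersection, and the minimum of these valuations is exponential.

Uniqueness: for exponential `w` and a suitable `N`, the value `w(x^N) = N w(x)` lies in the value
group of `v`, and it is the largest `δ` for which `a x^N` lies in `O_w` when `v a = -δ`. So the ring
determines `w`. Conversely, in a monic equation over `O_w` a root of negative value would have a
leading term smaller than all the others. -/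

/-! ### Vanishing sums and torsion of values over the base field -/

/-- If finitely many nonzero elements sum to zero, a nonarchimedean size takes the same value
on two of them. -/
theorem exists_ne_map_eq_of_sum_eq_zero {A α ι : Type*} [AddCommGroup A] [LinearOrder α]
    (N : A → α) (hadd : ∀ x y, N (x + y) ≤ max (N x) (N y)) (hneg : ∀ x, N (-x) = N x)
    (hzero : ∀ x, x ≠ 0 → N 0 < N x) (s : Finset ι) (hs : s.Nonempty) (t : ι → A)
    (ht : ∀ i ∈ s, t i ≠ 0) (hsum : ∑ i ∈ s, t i = 0) :
    ∃ i ∈ s, ∃ j ∈ s, i ≠ j ∧ N (t i) = N (t j) := by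
  classical
  obtain ⟨i, hi, hmax⟩ := s.exists_max_image (fun i => N (t i)) hs
  by_contra! h
  -- If the largest size is attained only at `i`, the remaining terms cannot add up to cancel `t i`.
  have hlt : ∀ r : Finset ι, r ⊆ s.erase i → N (∑ j ∈ r, t j) < N (t i) := by
    intro r
    induction r using Finset.induction_on with
    | empty => intro _; simpa using hzero _ (ht i hi)
    | insert a r ha ih =>
      intro hr
      rw [Finset.sum_insert ha]
      have has := Finset.mem_erase.1 (hr (Finset.mem_insert_self a r))
      exact (hadd _ _).trans_lt (max_lt (lt_of_le_of_ne (hmax a has.2)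
        (h a has.2 i hi has.1)) (ih fun b hb => hr (Finset.mem_insert_of_mem hb)))
  have h1 := hlt _ subset_rfl
  rw [← Finset.add_sum_erase s t hi] at hsum
  rw [eq_neg_of_add_eq_zero_right hsum, hneg] at h1
  exact h1.false

section

variable {F : Type*} {E : Type*} [Field F] [Field E] [Algebra F E]

theorem sum_support_minpoly (x : E) :
    ∑ i ∈ (minpoly F x).support, algebraMap F E ((minpoly F x).coeff i) * x ^ i = 0 := by
  have := minpoly.aeval F x
  rwa [Polynomial.aeval_def, Polynomial.eval₂_eq_sum, Polynomial.sum_def] at this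

/-- Two terms `c_i x^i` and `c_j x^j` of the minimal polynomial have equal value; dividing gives
`x^(j-i)` the value of `c_i / c_j`. -/
theorem Valuation.exists_pow_eq_algebraMap {Γ₀ : Type*} [LinearOrderedCommGroupWithZero Γ₀]
    (u : Valuation E Γ₀) {x : E} (hx : x ≠ 0) (hxi : IsIntegral F x) :
    ∃ (n : ℕ+) (a : F), a ≠ 0 ∧ u (x ^ (n : ℕ)) = u (algebraMap F E a) := by
  obtain ⟨i, hi, j, hj, hij, h⟩ := exists_ne_map_eq_of_sum_eq_zero u u.map_add u.map_neg
    (fun y hy => by simpa using zero_lt_iff.2 ((u.ne_zero_iff).2 hy)) (minpoly F x).support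
    (by simpa using minpoly.ne_zero hxi) _ (fun i hi => by simpa [hx] using hi)
    (sum_support_minpoly x)
  wlog hlt : i < j generalizing i j
  · exact this j hj i hi hij.symm h.symm (by omega)
  have hci : (minpoly F x).coeff i ≠ 0 := Polynomial.mem_support_iff.1 hi
  have hcj : (minpoly F x).coeff j ≠ 0 := Polynomial.mem_support_iff.1 hj
  refine ⟨⟨j - i, by omega⟩, (minpoly F x).coeff i / (minpoly F x).coeff j, div_ne_zero hci hcj, ?_⟩
  have hui : u x ^ i ≠ 0 := pow_ne_zero _ (u.ne_zero_iff.2 hx)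
  have hucj : u (algebraMap F E ((minpoly F x).coeff j)) ≠ 0 := u.ne_zero_iff.2 (by simpa using hcj)
  simp only [map_div₀, map_mul, map_pow, PNat.mk_coe] at h ⊢
  rw [eq_div_iff hucj, ← mul_left_inj' hui, h, mul_right_comm, ← pow_add,
    Nat.sub_add_cancel hlt.le, mul_comm]

end

/-! ### Valuation rings over `v`: incomparability and finiteness -/

/-- The valuation ring `V` of `E` lies over the valuation ring of `v`. -/
def ValuationSubring.LiesOver {F : Type*} {E : Type*} [Field F] [Field E] [Algebra F E]
    {Γ : Type*} [AddCommGroup Γ] [LinearOrder Γ] [IsOrderedAddMonoid Γ] (V : ValuationSubring E)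
    (v : AddValuation F (WithTop Γ)) : Prop :=
  ∀ a : F, algebraMap F E a ∈ V ↔ 0 ≤ v a

namespace ValuationSubring

variable {F : Type*} {E : Type*} [Field F] [Field E] [Algebra F E] {Γ : Type*} [AddCommGroup Γ]
  [LinearOrder Γ] [IsOrderedAddMonoid Γ] {v : AddValuation F (WithTop Γ)}

theorem LiesOver.valuation_le_iff {V : ValuationSubring E} (h : V.LiesOver v) (a b : F) :
    V.valuation (algebraMap F E a) ≤ V.valuation (algebraMap F E b) ↔ v b ≤ v a := by
  rcases eq_or_ne b 0 with rfl | hb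
  · simp
  have hb' : V.valuation (algebraMap F E b) ≠ 0 := by simpa using hb
  rw [← div_le_one₀ (zero_lt_iff.2 hb'), ← map_div₀, ← map_div₀, valuation_le_one_iff, h]
  have : a = a / b * b := by field_simp
  conv_rhs => rw [this, AddValuation.map_mul]
  have hvb : v b ≠ ⊤ := by simpa using hb
  lift v b to Γ using hvb with γ
  cases v (a / b) with
  | top => simp
  | coe δ => norm_cast; simp

/-- The equality of values between `x^n` and some `a` in `F` passes from `V` to the coarser `V'`,
and membership of `a` in either ring is decided by `v` alone. -/
theorem LiesOver.eq_of_le [Algebra.IsIntegral F E] {V V' : ValuationSubring E}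
    (h : V.LiesOver v) (h' : V'.LiesOver v) (hle : V ≤ V') : V = V' := by
  refine le_antisymm hle fun x hx => ?_
  rcases eq_or_ne x 0 with rfl | hx0
  · exact V.zero_mem
  obtain ⟨n, a, ha, hn⟩ :=
    V.valuation.exists_pow_eq_algebraMap (F := F) hx0 (Algebra.IsIntegral.isIntegral x)
  have hle' : V'.valuation (x ^ (n : ℕ)) = V'.valuation (algebraMap F E a) := by
    rw [← mapOfLE_valuation_apply V V' hle, hn, mapOfLE_valuation_apply]
  have h1 : V'.valuation (x ^ (n : ℕ)) ≤ 1 := by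
    rw [map_pow]; exact pow_le_one₀ zero_le ((V'.valuation_le_one_iff x).2 hx)
  rw [hle', valuation_le_one_iff, h', ← h, ← valuation_le_one_iff, ← hn, map_pow,
    pow_le_one_iff n.ne_zero, valuation_le_one_iff] at h1
  exact h1

open Polynomial in
/-- A monic integral polynomial whose value at `x` is a unit in each of the given valuation rings
that contain `x`. -/
theorem exists_monic_valuation_aeval_eq_one (S : Finset (ValuationSubring E)) (x : E) :
    ∃ f : ℤ[X], f.Monic ∧ f.natDegree ≠ 0 ∧
      ∀ V ∈ S, x ∈ V → V.valuation (aeval x f) = 1 := by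
  classical
  have hg : ∀ V : ValuationSubring E, ∃ g : ℤ[X], g.Monic ∧
      ((∃ g' : ℤ[X], g'.Monic ∧ V.valuation (aeval x g') < 1) → V.valuation (aeval x g) < 1) := by
    intro V
    by_cases h : ∃ g' : ℤ[X], g'.Monic ∧ V.valuation (aeval x g') < 1
    · exact ⟨h.choose, h.choose_spec.1, fun _ => h.choose_spec.2⟩
    · exact ⟨1, monic_one, fun h' => (h h').elim⟩
  choose g hgm hg using hg
  have hmem : ∀ V : ValuationSubring E, x ∈ V → ∀ q : ℤ[X], V.valuation (aeval x q) ≤ 1 := by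
    intro V hx q
    have : aeval x q = algebraMap V E (aeval (⟨x, hx⟩ : V) q) := by
      rw [← aeval_algebraMap_apply]; rfl
    rw [this]
    exact V.valuation_le_one _
  have hpm : (X * ∏ V ∈ S, g V).Monic := monic_X.mul (monic_prod_of_monic _ _ fun V _ => hgm V)
  have hdeg : (X * ∏ V ∈ S, g V).natDegree ≠ 0 := by
    rw [monic_X.natDegree_mul (monic_prod_of_monic _ _ fun V _ => hgm V)]
    simp
  have hdeg1 : degree (1 : ℤ[X]) < degree (X * ∏ V ∈ S, g V) := by
    rw [degree_one]
    exact natDegree_pos_iff_degree_pos.1 (Nat.pos_of_ne_zero hdeg)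
  have hm : (X * ∏ V ∈ S, g V + 1).Monic := hpm.add_of_left hdeg1
  -- If some monic polynomial has value below 1 at `x`, then `g V` does, and the new polynomial is 1
  -- plus a nonunit. Otherwise every monic polynomial, this one included, has value 1. The factor
  -- `X` keeps the degree positive.
  refine ⟨X * ∏ V ∈ S, g V + 1, hm, ?_, fun V hV hx => ?_⟩
  · rwa [natDegree_add_eq_left_of_degree_lt hdeg1]
  · by_cases h : ∃ g' : ℤ[X], g'.Monic ∧ V.valuation (aeval x g') < 1
    · obtain ⟨q, hq⟩ : g V ∣ X * ∏ V ∈ S, g V :=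
        (Finset.dvd_prod_of_mem g hV).trans (dvd_mul_left _ _)
      rw [hq, map_add, map_one, add_comm]
      apply Valuation.map_one_add_of_lt
      rw [map_mul, map_mul]
      exact mul_lt_one_of_lt_of_le (hg V h) (hmem V hx q)
    · push Not at h
      exact le_antisymm (hmem V hx _) (h _ hm)

/-- For `t` in `V` but not in `V'`, the element `1 / f(t)` works: `f(t)` is a unit in each ring of
`S` containing `t`, while a ring omitting `t` also omits `f(t)`, since otherwise `t` would be
integral over it. -/
theorem exists_valuation_eq_one_lt_one (S : Finset (ValuationSubring E))
    {V V' : ValuationSubring E} (hV : V ∈ S) (h : ¬ V ≤ V') :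
    ∃ y : E, (∀ W ∈ S, y ∈ W) ∧ V.valuation y = 1 ∧ V'.valuation y < 1 := by
  obtain ⟨t, ht, ht'⟩ := SetLike.not_le_iff_exists.1 h
  obtain ⟨f, hf, hdeg, hS⟩ := exists_monic_valuation_aeval_eq_one S t
  have key : ∀ W : ValuationSubring E, t ∉ W → W.valuation (Polynomial.aeval t f)⁻¹ < 1 := by
    intro W htW
    rw [map_inv₀]
    refine inv_lt_one_of_one_lt₀ ?_
    by_contra! hle
    rw [valuation_le_one_iff] at hle
    refine htW ?_
    have h1 : IsIntegral W t := by
      refine IsIntegral.of_aeval_monic (p := f.map (algebraMap ℤ W)) (hf.map _)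
        (by rwa [hf.natDegree_map]) ?_
      rw [Polynomial.aeval_map_algebraMap]
      exact isIntegral_algebraMap (R := W) (A := E) (x := ⟨_, hle⟩)
    obtain ⟨z, hz⟩ := IsIntegrallyClosed.isIntegral_iff.1 h1
    rw [← hz]
    exact z.2
  refine ⟨(Polynomial.aeval t f)⁻¹, fun W hW => ?_, ?_, key V' ht'⟩
  · rw [← valuation_le_one_iff]
    by_cases htW : t ∈ W
    · rw [map_inv₀, hS W hW htW, inv_one]
    · exact (key W htW).le
  · rw [map_inv₀, hS V hV ht, inv_one]

/-- Incomparability allows a choice of one `e` per ring, of value 1 there and below 1 at the other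
rings; such elements are linearly independent over `F`. -/
theorem card_le_finrank_of_liesOver [FiniteDimensional F E] (S : Finset (ValuationSubring E))
    (hS : ∀ V ∈ S, V.LiesOver v) : S.card ≤ Module.finrank F E := by
  classical
  have h : ∀ V : S, ∃ e : E, V.1.valuation e = 1 ∧ ∀ V' : S, V' ≠ V → V'.1.valuation e < 1 := by
    intro V
    have h1 : ∀ V' : S, ∃ y : E, (∀ W ∈ S, y ∈ W) ∧ V.1.valuation y = 1 ∧
        (V' ≠ V → V'.1.valuation y < 1) := by
      intro V'
      by_cases hVV : V' = V
      · exact ⟨1, fun W _ => W.one_mem, map_one _, fun h => (h hVV).elim⟩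
      · obtain ⟨y, hy, hy1, hy2⟩ := exists_valuation_eq_one_lt_one S V.2
          fun hle => hVV (Subtype.ext ((hS _ V.2).eq_of_le (hS _ V'.2) hle).symm)
        exact ⟨y, hy, hy1, fun _ => hy2⟩
    choose y hy hy1 hy2 using h1
    refine ⟨∏ V' : S, y V', by simp [hy1], fun V' hV' => ?_⟩
    rw [← Finset.mul_prod_erase _ _ (Finset.mem_univ V'), map_mul]
    refine mul_lt_one_of_lt_of_le (hy2 V' hV') ?_
    rw [valuation_le_one_iff]
    exact prod_mem fun W _ => hy W V' V'.2
  choose e he he' using h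
  have hli : LinearIndependent F e := by
    rw [Fintype.linearIndependent_iff]
    intro g hg
    by_contra! hne
    obtain ⟨i, hi⟩ := hne
    -- In a relation, look at the ring whose coefficient has least `v`: there its own term strictly
    -- dominates all the others.
    obtain ⟨m, -, hm⟩ := Finset.univ.exists_min_image (fun j => v (g j)) ⟨i, Finset.mem_univ i⟩
    have hgm : g m ≠ 0 := fun h0 => hi <| by
      have := hm i (Finset.mem_univ i)
      rw [h0, AddValuation.map_zero, top_le_iff] at this
      simpa using this
    have hum : m.1.valuation (algebraMap F E (g m)) ≠ 0 := by simpa using hgm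
    rw [← Finset.add_sum_erase _ _ (Finset.mem_univ m)] at hg
    have h2 : m.1.valuation (∑ j ∈ Finset.univ.erase m, g j • e j) <
        m.1.valuation (algebraMap F E (g m)) := by
      refine Valuation.map_sum_lt _ hum fun j hj => ?_
      rw [Algebra.smul_def, map_mul]
      calc _ ≤ m.1.valuation (algebraMap F E (g m)) * m.1.valuation (e j) := by
            gcongr
            exact ((hS _ m.2).valuation_le_iff _ _).2 (hm j (Finset.mem_univ j))
        _ < _ := by
            have := he' j m (Finset.ne_of_mem_erase hj).symm
            exact mul_lt_of_lt_one_right (zero_lt_iff.2 hum) this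
    rw [eq_neg_of_add_eq_zero_right hg, Valuation.map_neg, Algebra.smul_def, map_mul, he,
      mul_one] at h2
    exact h2.false
  simpa using hli.fintype_card_le_finrank

theorem finite_setOf_liesOver [FiniteDimensional F E] (v : AddValuation F (WithTop Γ)) :
    {V : ValuationSubring E | V.LiesOver v}.Finite := by
  by_contra h
  obtain ⟨S, hS, hcard⟩ := Set.Infinite.exists_subset_card_eq h (Module.finrank F E + 1)
  have := card_le_finrank_of_liesOver (F := F) S fun V hV => hS hV
  omega

end ValuationSubring

/-! ### Valuations with values in the divisible hull -/

namespace ValuationSubring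

variable {F : Type*} {E : Type*} [Field F] [Field E] [Algebra F E] {Γ : Type*} [AddCommGroup Γ]
  [LinearOrder Γ] [IsOrderedAddMonoid Γ] {v : AddValuation F (WithTop Γ)}

theorem LiesOver.mk_le_mk_iff {V : ValuationSubring E} (h : V.LiesOver v) {x y : E} {n m : ℕ+}
    {a b : F} {γ δ : Γ} (ha : v a = γ) (hb : v b = δ)
    (hx : V.valuation (x ^ (n : ℕ)) = V.valuation (algebraMap F E a))
    (hy : V.valuation (y ^ (m : ℕ)) = V.valuation (algebraMap F E b)) :
    DivisibleHull.mk γ n ≤ DivisibleHull.mk δ m ↔ V.valuation y ≤ V.valuation x := by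
  have h1 : v (a ^ (m : ℕ)) = (((m : ℕ) • γ : Γ) : WithTop Γ) := by
    rw [AddValuation.map_pow, ha, WithTop.coe_nsmul]
  have h2 : v (b ^ (n : ℕ)) = (((n : ℕ) • δ : Γ) : WithTop Γ) := by
    rw [AddValuation.map_pow, hb, WithTop.coe_nsmul]
  have h3 := h.valuation_le_iff (b ^ (n : ℕ)) (a ^ (m : ℕ))
  rw [DivisibleHull.mk_le_mk, ← WithTop.coe_le_coe, ← h1, ← h2, ← h3, map_pow, map_pow, map_pow,
    map_pow, ← hx, ← hy, map_pow, map_pow, ← pow_mul, ← pow_mul, mul_comm (m : ℕ),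
    pow_le_pow_iff_left₀ zero_le zero_le (by simp)]

/-- Put `u x = v(a) / n` whenever `x^n` and `a` have the same value at `V`. Cross-multiplication
shows that this is independent of the choices and reverses the order of the values of `V`. -/
theorem LiesOver.exists_addValuation [Algebra.IsIntegral F E] {V : ValuationSubring E}
    (h : V.LiesOver v) : ∃ u : AddValuation E (WithTop (DivisibleHull Γ)),
      (∀ a : F, u (algebraMap F E a) = (v a).map (fun γ : Γ => (γ : DivisibleHull Γ))) ∧
      ∀ x : E, 0 ≤ u x ↔ x ∈ V := by
  have hex : ∀ x : E, ∃ q : WithTop (DivisibleHull Γ), (x = 0 → q = ⊤) ∧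
      (x ≠ 0 → ∃ (n : ℕ+) (a : F) (γ : Γ), v a = γ ∧
        V.valuation (x ^ (n : ℕ)) = V.valuation (algebraMap F E a) ∧
        q = DivisibleHull.mk γ n) := by
    intro x
    by_cases hx : x = 0
    · exact ⟨⊤, fun _ => rfl, fun h => (h hx).elim⟩
    · obtain ⟨n, a, ha, hn⟩ :=
        V.valuation.exists_pow_eq_algebraMap (F := F) hx (Algebra.IsIntegral.isIntegral x)
      obtain ⟨γ, hγ⟩ := WithTop.ne_top_iff_exists.1 ((AddValuation.ne_top_iff v).2 ha)
      exact ⟨_, fun h => (hx h).elim, fun _ => ⟨n, a, γ, hγ.symm, hn, rfl⟩⟩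
  choose f hf0 hf using hex
  have huniq : ∀ (x : E) (n : ℕ+) (a : F) (γ : Γ), x ≠ 0 → v a = γ →
      V.valuation (x ^ (n : ℕ)) = V.valuation (algebraMap F E a) →
      f x = DivisibleHull.mk γ n := by
    intro x n a γ hx ha hn
    obtain ⟨m, b, δ, hb, hm, hfx⟩ := hf x hx
    rw [hfx, WithTop.coe_inj]
    exact le_antisymm ((h.mk_le_mk_iff hb ha hm hn).2 le_rfl)
      ((h.mk_le_mk_iff ha hb hn hm).2 le_rfl)
  have hle : ∀ x y : E, f x ≤ f y ↔ V.valuation y ≤ V.valuation x := by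
    intro x y
    by_cases hy : y = 0
    · rw [hf0 y hy, hy]
      simp
    by_cases hx : x = 0
    · obtain ⟨m, b, δ, hb, hm, hfy⟩ := hf y hy
      rw [hf0 x hx, hfy]
      simp [hx, hy]
    obtain ⟨n, a, γ, ha, hn, hfx⟩ := hf x hx
    obtain ⟨m, b, δ, hb, hm, hfy⟩ := hf y hy
    rw [hfx, hfy, WithTop.coe_le_coe, h.mk_le_mk_iff ha hb hn hm]
  have hF : ∀ a : F, f (algebraMap F E a) = (v a).map (fun γ : Γ => (γ : DivisibleHull Γ)) := by
    intro a
    by_cases ha : a = 0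
    · simp [hf0 _, ha]
    · obtain ⟨γ, hγ⟩ := WithTop.ne_top_iff_exists.1 ((AddValuation.ne_top_iff v).2 ha)
      rw [huniq (algebraMap F E a) 1 a γ (by simpa) hγ.symm (by simp), ← hγ]
      rfl
  have hone : f 1 = 0 := by
    have := hF 1
    rw [map_one, AddValuation.map_one] at this
    rw [this, ← WithTop.coe_zero, WithTop.map_coe]
    simp
  refine ⟨AddValuation.of f (hf0 0 rfl) hone (fun x y => ?_) (fun x y => ?_), hF, fun x => ?_⟩
  · rw [min_le_iff, hle, hle]
    exact le_max_iff.1 (V.valuation.map_add x y)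
  · by_cases hx : x = 0
    · rw [hx, zero_mul, hf0 0 rfl, top_add]
    by_cases hy : y = 0
    · rw [hy, mul_zero, hf0 0 rfl, add_top]
    obtain ⟨n, a, γ, ha, hn, hfx⟩ := hf x hx
    obtain ⟨m, b, δ, hb, hm, hfy⟩ := hf y hy
    rw [hfx, hfy, ← WithTop.coe_add, DivisibleHull.mk_add_mk]
    -- `(xy)^(nm)` has the value of `a^m b^n`, which realizes the sum of the two fractions.
    refine huniq _ _ (a ^ (m : ℕ) * b ^ (n : ℕ)) _ (mul_ne_zero hx hy) ?_ ?_
    · rw [AddValuation.map_mul, AddValuation.map_pow, AddValuation.map_pow, ha, hb]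
      norm_cast
    · simp only [map_mul, map_pow, PNat.mul_coe, mul_pow] at hn hm ⊢
      rw [← hn, ← hm, ← pow_mul, ← pow_mul, mul_comm (m : ℕ)]
  · change 0 ≤ f x ↔ _
    rw [← hone, hle, map_one, valuation_le_one_iff]

end ValuationSubring

/-! ### Separating elements from an integrally closed subring -/

open Polynomial Algebra in
/-- A subring of a field that is integrally closed in it is the intersection of the valuation
rings that contain it and dominate it along its Jacobson radical. -/
theorem Subring.exists_valuationSubring_jacobson_subset_nonunits {K : Type*} [Field K]
    {R : Subring K} [IsIntegrallyClosedIn R K] {x : K} (hxR : x ∉ R) :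
    ∃ V : ValuationSubring K, R ≤ V.toSubring ∧ x ∉ V ∧
      ∀ r : R, r ∈ (⊥ : Ideal R).jacobson → (r : K) ∈ V.nonunits := by
  obtain rfl | hx0 := eq_or_ne x 0
  · exact (hxR R.zero_mem).elim
  let := invertibleOfNonzero hx0
  let B := Algebra.adjoin R {x⁻¹}
  let xinv : B.toSubring := ⟨x⁻¹, subset_adjoin rfl⟩
  have hR : Nontrivial R := inferInstance
  have hJ : (⊥ : Ideal R).jacobson ≠ ⊤ := by
    rw [Ne, Ideal.jacobson_eq_top_iff]
    exact bot_ne_top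
  -- The radical and `x⁻¹` generate a proper ideal of `R[x⁻¹]`: otherwise `x` is a root of a
  -- polynomial whose leading coefficient is 1 modulo the radical, hence a unit, and `x` is integral
  -- over `R`.
  have : ((⊥ : Ideal R).jacobson).map (algebraMap _ B) + .span {xinv} ≠ ⊤ := fun eq ↦ hxR <|
    have ⟨p, hp, hpx⟩ := exists_aeval_invOf_eq_zero_of_idealMap_adjoin_sup_span_eq_top _ _
      hJ eq
    have H : IsUnit p.leadingCoeff := by
      simpa using Ideal.mem_jacobson_bot.1 hp 1
    (Subring.isIntegrallyClosedIn_iff).mp ‹_›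
      ⟨.C H.unit⁻¹.1 * p, by simp [Polynomial.Monic], by simpa using .inr hpx⟩
  have ⟨V, hV⟩ := Ideal.image_subset_nonunits_valuationSubring (A := B.toSubring) _ this
  exact ⟨V, fun r hr ↦ hV.1 (B.algebraMap_mem ⟨r, hr⟩), (V.inv_mem_nonunits_iff.mp <|
      hV.2 ⟨_, le_add_self (α := Ideal B) (Ideal.subset_span rfl), rfl⟩).resolve_left hx0,
    fun r hr => hV.2 ⟨_, le_self_add (α := Ideal B) (Ideal.mem_map_of_mem _ hr), rfl⟩⟩

/-! ### The ring of a quasi-valuation -/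

namespace QuasiValuation

section

variable {F : Type*} [Field F] {E : Type*} [Field E] [Algebra F E] {Γ : Type*}
  [AddCommGroup Γ] [LinearOrder Γ] [IsOrderedAddMonoid Γ] {M : Type*} [AddCommMonoid M]
  [LinearOrder M] [IsOrderedAddMonoid M] {w : QuasiValuation E M} {v : AddValuation F (WithTop Γ)}

theorem Extends.map_neg (h : w.Extends v) (x : E) : w (-x) = w x := by
  have key : ∀ y : E, w y ≤ w (-y) := fun y => by
    have := w.map_mul' (-1) y
    rwa [h.map_neg_one, zero_add, neg_one_mul] at this
  exact le_antisymm (by simpa using key (-x)) (key x)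

theorem Extends.map_ne_top (h : w.Extends v) {x : E} (hx : x ≠ 0) : w x ≠ ⊤ := by
  intro htop
  have := w.map_mul' x x⁻¹
  rw [htop, WithTop.top_add, mul_inv_cancel₀ hx, h.map_one, top_le_iff] at this
  exact WithTop.top_ne_zero this.symm

theorem coe_mem_valueMonoid {x : E} {m : M} (hx : x ≠ 0) (hm : w x = m) : m ∈ w.valueMonoid :=
  AddSubmonoid.subset_closure ⟨x, hx, hm⟩

theorem Extends.nonneg_iff (h : w.Extends v) (a : F) : 0 ≤ w (algebraMap F E a) ↔ 0 ≤ v a := by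
  obtain ⟨ι, hι, hext⟩ := h
  cases ha : v a with
  | top =>
    rw [AddValuation.top_iff] at ha
    simp [ha, w.map_zero']
  | coe γ =>
    rw [hext a ⟨γ, a, ha⟩ ha, ← WithTop.coe_zero, ← WithTop.coe_zero, WithTop.coe_le_coe,
      WithTop.coe_le_coe, ← ι.map_zero, hι.le_iff_le]
    rfl

/-- Multiplying back by `a⁻¹`, whose value is exactly `-γ`, turns the product inequality into an
equality. -/
theorem Extends.map_algebraMap_mul {ι : valueGroup v →+ M}
    (hext : ∀ (a : F) (γ : valueGroup v), v a = ((γ : Γ) : WithTop Γ) →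
      w (algebraMap F E a) = (ι γ : WithTop M))
    {a : F} {γ : valueGroup v} (ha : v a = ((γ : Γ) : WithTop Γ)) (x : E) :
    w (algebraMap F E a * x) = ι γ + w x := by
  have ha0 : a ≠ 0 := by
    rintro rfl
    simp at ha
  have hinv : w (algebraMap F E a⁻¹) = (ι (-γ) : WithTop M) :=
    hext _ _ (by rw [AddValuation.map_inv, ha]; rfl)
  refine le_antisymm ?_ (by simpa [hext a γ ha] using w.map_mul' (algebraMap F E a) x)
  have h1 := w.map_mul' (algebraMap F E a⁻¹) (algebraMap F E a * x)
  rw [hinv, ← mul_assoc, ← map_mul, inv_mul_cancel₀ ha0, _root_.map_one, one_mul] at h1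
  calc w (algebraMap F E a * x)
      = ι γ + (ι (-γ) + w (algebraMap F E a * x)) := by
        rw [← add_assoc, ← WithTop.coe_add, ← ι.map_add, add_neg_cancel, ι.map_zero,
          WithTop.coe_zero, zero_add]
    _ ≤ _ := by gcongr

theorem map_le_sum {ι : Type*} (s : Finset ι) (t : ι → E) {g : WithTop M}
    (h : ∀ i ∈ s, g ≤ w (t i)) : g ≤ w (∑ i ∈ s, t i) := by
  classical
  induction s using Finset.induction_on with
  | empty => simp [w.map_zero']
  | insert a s ha ih =>
    rw [Finset.sum_insert ha]
    exact (le_min (h a (Finset.mem_insert_self a s))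
      (ih fun i hi => h i (Finset.mem_insert_of_mem hi))).trans (w.map_add' _ _)

/-- Elements of positive value of the base field lie in the Jacobson radical of the
quasi-valuation ring. -/
theorem Extends.mem_jacobson (h : w.Extends v) (hw : IsWeaklyCancellative w.valueMonoid) {a : F}
    (ha : 0 < v a) :
    (⟨algebraMap F E a, (h.nonneg_iff a).2 ha.le⟩ : w.ring h) ∈
      (⊥ : Ideal (w.ring h)).jacobson := by
  rw [Ideal.mem_jacobson_bot]
  rintro ⟨r, hr⟩
  have hr : 0 ≤ w r := hr
  rcases eq_or_ne a 0 with rfl | ha0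
  · convert isUnit_one
    simp
  obtain ⟨γ₀, hγ₀⟩ := WithTop.ne_top_iff_exists.1 ((AddValuation.ne_top_iff v).2 ha0)
  obtain ⟨γ, hγ⟩ : ∃ γ : valueGroup v, v a = ((γ : Γ) : WithTop Γ) :=
    ⟨⟨γ₀, a, hγ₀.symm⟩, hγ₀.symm⟩
  obtain ⟨ι, hι, hext⟩ := id h
  have hpos : 0 < ι γ := by
    rw [← ι.map_zero]
    refine hι ?_
    rw [hγ] at ha
    exact_mod_cast ha
  have hz : algebraMap F E a * r + 1 ≠ 0 := by
    intro h0
    have h1 := Extends.map_algebraMap_mul hext hγ r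
    rw [eq_neg_of_add_eq_zero_left h0, h.map_neg_one] at h1
    have : (0 : WithTop M) < ι γ + w r :=
      add_pos_of_pos_of_nonneg (by exact_mod_cast hpos) hr
    exact this.ne h1
  set y := (algebraMap F E a * r + 1)⁻¹ with hy
  have hy0 : y ≠ 0 := inv_ne_zero hz
  -- Since `y = 1 - a r y`, a negative `w y` would satisfy `w y ≥ ι γ + w y`; weak cancellation then
  -- forces `ι γ = 0`.
  have hyr : 0 ≤ w y := by
    by_contra! hlt
    obtain ⟨m, hm⟩ := WithTop.ne_top_iff_exists.1 (h.map_ne_top hy0)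
    have hyeq : y = 1 + algebraMap F E a * (-r * y) := by
      have : y * (algebraMap F E a * r + 1) = 1 := inv_mul_cancel₀ hz
      linear_combination this
    have h1 := w.map_add' 1 (algebraMap F E a * (-r * y))
    rw [← hyeq, h.map_one, min_le_iff, or_iff_right hlt.not_ge,
      Extends.map_algebraMap_mul hext hγ] at h1
    have h2 : ι γ + w y ≤ w y := by
      refine le_trans ?_ h1
      gcongr
      refine le_trans ?_ (w.map_mul' _ _)
      rw [h.map_neg]
      exact le_add_of_nonneg_left hr
    rw [← hm, ← WithTop.coe_add, WithTop.coe_le_coe] at h2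
    have h3 : m + ι γ = m := le_antisymm (by rwa [add_comm]) (le_add_of_nonneg_right hpos.le)
    have h4 := hw ⟨m, coe_mem_valueMonoid hy0 hm.symm⟩
      ⟨ι γ, coe_mem_valueMonoid ((map_ne_zero _).2 ha0) (hext a γ hγ)⟩ (Subtype.ext h3)
    exact hpos.ne' (congrArg Subtype.val h4)
  rw [isUnit_iff_exists_inv]
  exact ⟨⟨y, hyr⟩, Subtype.ext (mul_inv_cancel₀ hz)⟩

/-- If `v a < 0`, then `a⁻¹` lies in the Jacobson radical, so it is a nonunit of `V` and `a` is not
in `V`. -/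
theorem Extends.liesOver (h : w.Extends v) (hw : IsWeaklyCancellative w.valueMonoid)
    {V : ValuationSubring E} (hle : w.ring h ≤ V.toSubring)
    (hV : ∀ r : w.ring h, r ∈ (⊥ : Ideal (w.ring h)).jacobson → (r : E) ∈ V.nonunits) :
    V.LiesOver v := by
  intro a
  refine ⟨fun ha => ?_, fun ha => hle ((h.nonneg_iff a).2 ha)⟩
  by_contra! hlt
  have ha0 : a ≠ 0 := by
    rintro rfl
    simp at hlt
  have hpos : 0 < v a⁻¹ := by
    obtain ⟨γ, hγ⟩ := WithTop.ne_top_iff_exists.1 ((AddValuation.ne_top_iff v).2 ha0)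
    rw [AddValuation.map_inv, ← hγ]
    rw [← hγ] at hlt
    have : γ < 0 := by exact_mod_cast hlt
    exact WithTop.coe_lt_coe.2 (neg_pos.2 this)
  have h1 : (algebraMap F E a)⁻¹ ∈ V.nonunits := by
    rw [← map_inv₀]
    exact hV _ (h.mem_jacobson hw hpos)
  rw [ValuationSubring.inv_mem_nonunits_iff] at h1
  exact h1.elim (by simpa using ha0) fun h2 => h2 ha

theorem Extends.exists_finset_addValuation [FiniteDimensional F E] (h : w.Extends v)
    (hw : IsWeaklyCancellative w.valueMonoid) [IsIntegrallyClosedIn (w.ring h) E] :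
    ∃ U : Finset (AddValuation E (WithTop (DivisibleHull Γ))), U.Nonempty ∧
      (∀ u ∈ U, ∀ a : F,
        u (algebraMap F E a) = (v a).map (fun γ : Γ => (γ : DivisibleHull Γ))) ∧
      ∀ x : E, x ∈ w.ring h ↔ ∀ u ∈ U, 0 ≤ u x := by
  classical
  have hex := fun V : {V : ValuationSubring E // V.LiesOver v} => V.2.exists_addValuation
  choose f hfF hf using hex
  have hfin : (Set.range fun V : {V : {V : ValuationSubring E // V.LiesOver v} //
      w.ring h ≤ V.1.toSubring} => f V.1).Finite := by
    have : Finite {V : ValuationSubring E // V.LiesOver v} :=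
      (ValuationSubring.finite_setOf_liesOver (E := E) v).to_subtype
    exact Set.finite_range _
  have hmem : ∀ u, u ∈ hfin.toFinset ↔ ∃ V : {V : ValuationSubring E // V.LiesOver v},
      w.ring h ≤ V.1.toSubring ∧ f V = u := by
    intro u
    simp
  have hsep : ∀ x ∉ w.ring h, ∃ u ∈ hfin.toFinset, ¬ 0 ≤ u x := by
    intro x hx
    obtain ⟨V, hle, hxV, hV⟩ := Subring.exists_valuationSubring_jacobson_subset_nonunits hx
    exact ⟨_, (hmem _).2 ⟨⟨V, h.liesOver hw hle hV⟩, hle, rfl⟩, fun h0 => hxV ((hf _ x).1 h0)⟩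
  refine ⟨hfin.toFinset, ?_, fun u hu a => ?_, fun x => ⟨fun hx u hu => ?_, fun hx => ?_⟩⟩
  -- When the ring is all of `E` there is nothing to separate; then `v` is nonnegative on `F`, and
  -- the trivial valuation ring `⊤` lies over it.
  · by_cases htop : ∀ x, x ∈ w.ring h
    · refine ⟨_, (hmem _).2 ⟨⟨⊤, fun a => ?_⟩, fun x _ => ValuationSubring.mem_top x, rfl⟩⟩
      exact ⟨fun _ => (h.nonneg_iff a).1 (htop _), fun _ => ValuationSubring.mem_top _⟩
    · push Not at htop
      obtain ⟨x, hx⟩ := htop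
      obtain ⟨u, hu, -⟩ := hsep x hx
      exact ⟨u, hu⟩
  · obtain ⟨V, -, rfl⟩ := (hmem u).1 hu
    exact hfF V a
  · obtain ⟨V, hle, rfl⟩ := (hmem u).1 hu
    exact (hf V x).2 (hle hx)
  · by_contra hxR
    obtain ⟨u, hu, hux⟩ := hsep x hxR
    exact hux (hx u hu)

/-- The ring of an exponential quasi-valuation with weakly cancellative value monoid is
integrally closed. -/
theorem IsExponential.isIntegrallyClosedIn (h : w.Extends v)
    (hw : IsWeaklyCancellative w.valueMonoid) (he : w.IsExponential) :
    IsIntegrallyClosedIn (w.ring h) E := by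
  rw [Subring.isIntegrallyClosedIn_iff]
  rintro x ⟨p, hp, hpx⟩
  change 0 ≤ w x
  by_contra! hlt
  have hx : x ≠ 0 := by
    rintro rfl
    simp [w.map_zero'] at hlt
  obtain ⟨m, hm⟩ := WithTop.ne_top_iff_exists.1 (h.map_ne_top hx)
  have hm0 : m < 0 := by
    rw [← hm] at hlt
    exact_mod_cast hlt
  have hxp : ∀ n : ℕ, w (x ^ n) = ((n • m : M) : WithTop M) := by
    intro n
    rcases Nat.eq_zero_or_pos n with rfl | hn
    · simpa using h.map_one
    · rw [he x n hn, ← hm, WithTop.coe_nsmul]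
  obtain ⟨n, hn⟩ : ∃ n, p.natDegree = n + 1 := by
    refine Nat.exists_eq_succ_of_ne_zero fun h0 => ?_
    rw [hp.natDegree_eq_zero.1 h0] at hpx
    simp at hpx
  rw [Polynomial.eval₂_eq_sum_range, hn, Finset.sum_range_succ, ← hn, hp.coeff_natDegree, map_one,
    one_mul, hn] at hpx
  -- As `m < 0`, all terms of degree at most `n` have value at least `n • m`. The leading term has
  -- value `(n + 1) • m`, so `n • m + m = n • m`, against weak cancellation.
  have hsum : ((n • m : M) : WithTop M) ≤
      w (∑ i ∈ Finset.range (n + 1), algebraMap (w.ring h) E (p.coeff i) * x ^ i) := by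
    refine map_le_sum _ _ fun i hi => ?_
    have hc : 0 ≤ w (algebraMap (w.ring h) E (p.coeff i)) := (p.coeff i).2
    refine le_trans ?_ (w.map_mul' _ _)
    rw [hxp]
    refine le_trans ?_ (le_add_of_nonneg_left hc)
    obtain ⟨k, rfl⟩ := Nat.exists_eq_add_of_le (Nat.lt_succ_iff.1 (Finset.mem_range.1 hi))
    rw [WithTop.coe_le_coe, add_nsmul]
    exact add_le_of_nonpos_right (nsmul_nonpos hm0.le k)
  rw [← h.map_neg, ← eq_neg_of_add_eq_zero_right hpx, hxp, WithTop.coe_le_coe, succ_nsmul] at hsum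
  have heq : n • m + m = n • m := le_antisymm (add_le_of_nonpos_right hm0.le) hsum
  have hmem := coe_mem_valueMonoid hx hm.symm
  have := hw ⟨n • m, nsmul_mem hmem n⟩ ⟨m, hmem⟩ (Subtype.ext heq)
  exact hm0.ne (congrArg Subtype.val this)

end

/-! ### Minima of finitely many valuations -/

section

variable {E : Type*} [Field E] {G : Type*} [AddCommGroup G] [LinearOrder G] [IsOrderedAddMonoid G]

/-- The minimum of finitely many valuations. -/
def minimum (U : Finset (AddValuation E (WithTop G))) (hU : U.Nonempty) : QuasiValuation E G where
  toFun x := U.inf' hU (fun u => u x)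
  map_zero' := by simp
  map_mul' x y := Finset.le_inf' _ _ fun u hu => by
    rw [AddValuation.map_mul]
    exact add_le_add (Finset.inf'_le _ hu) (Finset.inf'_le _ hu)
  map_add' x y := Finset.le_inf' _ _ fun u hu =>
    (min_le_min (Finset.inf'_le _ hu) (Finset.inf'_le _ hu)).trans (u.map_add x y)

theorem minimum_apply (U : Finset (AddValuation E (WithTop G))) (hU : U.Nonempty) (x : E) :
    minimum U hU x = U.inf' hU (fun u => u x) := rfl

theorem isExponential_minimum (U : Finset (AddValuation E (WithTop G))) (hU : U.Nonempty) :
    (minimum U hU).IsExponential := by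
  intro x n _
  simp only [minimum_apply, AddValuation.map_pow]
  apply le_antisymm
  · obtain ⟨u, hu, h⟩ := U.exists_mem_eq_inf' hU (fun u => u x)
    rw [h]
    exact Finset.inf'_le _ hu
  · exact Finset.le_inf' _ _ fun u hu => nsmul_le_nsmul_right (Finset.inf'_le _ hu) n

theorem isWeaklyCancellative_valueMonoid (w : QuasiValuation E G) :
    IsWeaklyCancellative w.valueMonoid := fun a b h => by
  have := congrArg Subtype.val h
  exact Subtype.ext (by simpa using this)

end

end QuasiValuation

/-! ### An exponential quasi-valuation is determined by its ring -/

namespace QuasiValuation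

variable {F : Type*} [Field F] {E : Type*} [Field E] [Algebra F E] {Γ : Type*}
  [AddCommGroup Γ] [LinearOrder Γ] [IsOrderedAddMonoid Γ] {M : Type*} [AddCommMonoid M]
  [LinearOrder M] [IsOrderedAddMonoid M] {w : QuasiValuation E M} {v : AddValuation F (WithTop Γ)}
  {ι : valueGroup v →+ M}

theorem Extends.map_mem_valueMonoid
    (hext : ∀ (a : F) (γ : valueGroup v), v a = ((γ : Γ) : WithTop Γ) →
      w (algebraMap F E a) = (ι γ : WithTop M)) (γ : valueGroup v) : ι γ ∈ w.valueMonoid := by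
  obtain ⟨a, ha⟩ := γ.2
  refine coe_mem_valueMonoid (x := algebraMap F E a) (fun h0 => ?_) (hext a γ ha)
  rw [(map_eq_zero _).1 h0, AddValuation.map_zero] at ha
  exact WithTop.top_ne_coe ha

/-- The values of an exponential quasi-valuation are torsion over the value group of `v`. -/
theorem IsExponential.exists_nsmul_eq (he : w.IsExponential) (hι : StrictMono ι)
    (hext : ∀ (a : F) (γ : valueGroup v), v a = ((γ : Γ) : WithTop Γ) →
      w (algebraMap F E a) = (ι γ : WithTop M))
    (hw : IsWeaklyCancellative w.valueMonoid) {x : E} (hx : x ≠ 0) (hxi : IsIntegral F x)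
    {m : M} (hm : w x = m) : ∃ (n : ℕ+) (γ : valueGroup v), (n : ℕ) • m = ι γ := by
  have h : w.Extends v := ⟨ι, hι, hext⟩
  obtain ⟨i, hi, j, hj, hij, hijw⟩ := exists_ne_map_eq_of_sum_eq_zero
    (fun y => OrderDual.toDual (w y)) (fun y z => w.map_add' y z) h.map_neg
    (fun y hy => by
      simp only [w.map_zero']
      exact (lt_top_iff_ne_top.2 (h.map_ne_top hy)))
    (minpoly F x).support
    (by simpa using minpoly.ne_zero hxi) _ (fun i hi => by simpa [hx] using hi)
    (sum_support_minpoly x)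
  wlog hlt : i < j generalizing i j
  · exact this j hj i hi hij.symm hijw.symm (by omega)
  have hxp : ∀ n : ℕ, w (x ^ n) = ((n • m : M) : WithTop M) := by
    intro n
    rcases Nat.eq_zero_or_pos n with rfl | hn
    · simpa using h.map_one
    · rw [he x n hn, hm, WithTop.coe_nsmul]
  have hc : ∀ k ∈ (minpoly F x).support, ∃ γ : valueGroup v,
      v ((minpoly F x).coeff k) = ((γ : Γ) : WithTop Γ) := by
    intro k hk
    obtain ⟨γ, hγ⟩ := WithTop.ne_top_iff_exists.1
      ((AddValuation.ne_top_iff v).2 (Polynomial.mem_support_iff.1 hk))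
    exact ⟨⟨γ, _, hγ.symm⟩, hγ.symm⟩
  obtain ⟨γ, hγ⟩ := hc i hi
  obtain ⟨δ, hδ⟩ := hc j hj
  obtain ⟨k, hk0, rfl⟩ : ∃ k, 0 < k ∧ j = i + k := ⟨j - i, by omega, by omega⟩
  have h1 : ι γ + i • m = ι δ + (i + k) • m := by
    have := OrderDual.toDual_inj.1 hijw
    rw [Extends.map_algebraMap_mul hext hγ, Extends.map_algebraMap_mul hext hδ, hxp, hxp] at this
    exact_mod_cast this
  -- Values in `M` cannot be subtracted, but those from `F` can; the equality is arranged as `b + c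
  -- = b` for weak cancellation.
  have h2 : i • m + (ι (δ - γ) + k • m) = i • m := by
    calc i • m + (ι (δ - γ) + k • m) = ι (-γ) + (ι δ + (i + k) • m) := by
          rw [sub_eq_neg_add, ι.map_add, add_nsmul]
          abel
      _ = i • m := by
          rw [← h1, ← add_assoc, ← ι.map_add, neg_add_cancel, ι.map_zero, zero_add]
  have hmem := coe_mem_valueMonoid hx hm
  have h3 := congrArg Subtype.val (hw ⟨i • m, nsmul_mem hmem i⟩
    ⟨ι (δ - γ) + k • m, add_mem (Extends.map_mem_valueMonoid hext _) (nsmul_mem hmem k)⟩ (Subtype.ext h2))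
  refine ⟨⟨k, hk0⟩, γ - δ, ?_⟩
  calc k • m = ι (γ - δ) + (ι (δ - γ) + k • m) := by
        rw [← add_assoc, ← ι.map_add, sub_add_sub_cancel, sub_self, ι.map_zero, zero_add]
    _ = ι (γ - δ) := by
        rw [show ι (δ - γ) + k • m = 0 from h3, add_zero]

theorem IsExponential.exists_nsmul_eq_of_mem_valueMonoid [Algebra.IsIntegral F E]
    (he : w.IsExponential) (hι : StrictMono ι)
    (hext : ∀ (a : F) (γ : valueGroup v), v a = ((γ : Γ) : WithTop Γ) →
      w (algebraMap F E a) = (ι γ : WithTop M))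
    (hw : IsWeaklyCancellative w.valueMonoid) {m : M} (hm : m ∈ w.valueMonoid) :
    ∃ (n : ℕ+) (γ : valueGroup v), (n : ℕ) • m = ι γ := by
  induction hm using AddSubmonoid.closure_induction with
  | mem m hm =>
    obtain ⟨x, hx, hxm⟩ := hm
    exact he.exists_nsmul_eq hι hext hw hx (Algebra.IsIntegral.isIntegral x) hxm
  | zero => exact ⟨1, 0, by simp⟩
  | add m m' _ _ h h' =>
    obtain ⟨n, γ, h⟩ := h
    obtain ⟨n', γ', h'⟩ := h'
    refine ⟨n * n', (n' : ℕ) • γ + (n : ℕ) • γ', ?_⟩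
    rw [ι.map_add, map_nsmul, map_nsmul, ← h, ← h', nsmul_add, PNat.mul_coe, mul_smul, smul_comm,
      mul_smul]

theorem extends_of_map_coe {w : QuasiValuation E (DivisibleHull Γ)}
    (hw : ∀ a : F, w (algebraMap F E a) = (v a).map (fun γ : Γ => (γ : DivisibleHull Γ))) :
    w.Extends v := by
  refine ⟨(DivisibleHull.coeAddMonoidHom Γ).comp (valueGroup v).subtype, fun γ δ h => ?_,
    fun a γ ha => ?_⟩
  · simpa using h
  · rw [hw, ha]
    rfl

/-- An exponential quasi-valuation extending `v` is determined by its ring. -/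
theorem IsExponential.map_eq_mk {w' : QuasiValuation E (DivisibleHull Γ)}
    (he : w.IsExponential) (hι : StrictMono ι)
    (hext : ∀ (a : F) (γ : valueGroup v), v a = ((γ : Γ) : WithTop Γ) →
      w (algebraMap F E a) = (ι γ : WithTop M))
    (he' : w'.IsExponential)
    (hw' : ∀ a : F, w' (algebraMap F E a) = (v a).map (fun γ : Γ => (γ : DivisibleHull Γ)))
    (hring : ∀ x, 0 ≤ w x ↔ 0 ≤ w' x) {x : E} (hx : x ≠ 0) (hxi : IsIntegral F x) {m : M}
    (hm : w x = m) {n : ℕ+} {γ : valueGroup v} (hn : (n : ℕ) • m = ι γ) :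
    w' x = (DivisibleHull.mk (γ : Γ) n : WithTop (DivisibleHull Γ)) := by
  have h' := extends_of_map_coe hw'
  obtain ⟨q, hq⟩ := WithTop.ne_top_iff_exists.1 (h'.map_ne_top hx)
  let ι' := (DivisibleHull.coeAddMonoidHom Γ).comp (valueGroup v).subtype
  have hι' : StrictMono ι' := fun γ δ h => by simpa [ι'] using h
  have hext' : ∀ (a : F) (γ : valueGroup v), v a = ((γ : Γ) : WithTop Γ) →
      w' (algebraMap F E a) = (ι' γ : WithTop (DivisibleHull Γ)) := by
    intro a γ ha
    rw [hw', ha]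
    rfl
  obtain ⟨n', γ', hn'⟩ := he'.exists_nsmul_eq hι' hext' (isWeaklyCancellative_valueMonoid w') hx hxi
    hq.symm
  have hwN : w (x ^ ((n : ℕ) * n')) = ((ι ((n' : ℕ) • γ) : M) : WithTop M) := by
    rw [he x _ (by positivity), hm, ← WithTop.coe_nsmul, map_nsmul, ← hn, mul_nsmul]
  have hwN' : w' (x ^ ((n : ℕ) * n')) =
      ((ι' ((n : ℕ) • γ') : DivisibleHull Γ) : WithTop (DivisibleHull Γ)) := by
    rw [he' x _ (by positivity), ← hq, ← WithTop.coe_nsmul, map_nsmul, ← hn', mul_comm, mul_nsmul]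
  -- With the exponent `n * n'` both values lie in the value group; scaling by an element of `F` of
  -- value `-δ` turns ring membership into comparison with `δ`.
  have key : ∀ δ : valueGroup v, δ ≤ (n' : ℕ) • γ ↔ δ ≤ (n : ℕ) • γ' := by
    intro δ
    obtain ⟨a, ha⟩ := (-δ).2
    have h1 := hring (algebraMap F E a * x ^ ((n : ℕ) * n'))
    rw [Extends.map_algebraMap_mul hext ha, Extends.map_algebraMap_mul hext' ha, hwN, hwN',
      ← WithTop.coe_add, ← WithTop.coe_add, ← ι.map_add, ← ι'.map_add, ← WithTop.coe_zero,
      ← WithTop.coe_zero, WithTop.coe_le_coe, WithTop.coe_le_coe, ← ι.map_zero, ← ι'.map_zero,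
      hι.le_iff_le, hι'.le_iff_le] at h1
    simpa [← sub_eq_neg_add] using h1
  have heq : (n' : ℕ) • γ = (n : ℕ) • γ' := le_antisymm ((key _).1 le_rfl) ((key _).2 le_rfl)
  rw [← hq, WithTop.coe_inj]
  induction q using DivisibleHull.ind with
  | mk δ k =>
    have h2 : DivisibleHull.mk ((n' : ℕ) • δ) k = DivisibleHull.mk (γ' : Γ) 1 := by
      rw [← DivisibleHull.nsmul_mk]
      exact hn'
    rw [DivisibleHull.mk_eq_mk_iff_smul_eq_smul] at h2 ⊢
    have h3 : (n' : ℕ) • (γ : Γ) = (n : ℕ) • (γ' : Γ) := by exact_mod_cast congrArg Subtype.val heq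
    refine nsmul_right_injective n'.ne_zero ?_
    change (n' : ℕ) • ((n : ℕ) • δ) = (n' : ℕ) • ((k : ℕ) • (γ : Γ))
    rw [PNat.one_coe, one_nsmul] at h2
    rw [smul_comm, h2, smul_comm (n' : ℕ), h3, smul_comm]

/-- The isomorphism sends `m` to `γ / n` whenever `n • m = ι γ`; by `map_eq_mk` it carries the
values of `w` to those of `w'`. -/
theorem IsExponential.equivalent_of_ring_eq [Algebra.IsIntegral F E]
    {w' : QuasiValuation E (DivisibleHull Γ)} (he : w.IsExponential) (h : w.Extends v)
    (hw : IsWeaklyCancellative w.valueMonoid) (he' : w'.IsExponential)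
    (hw' : ∀ a : F, w' (algebraMap F E a) = (v a).map (fun γ : Γ => (γ : DivisibleHull Γ)))
    (hring : ∀ x, 0 ≤ w x ↔ 0 ≤ w' x) : w.Equivalent w' := by
  obtain ⟨ι, hι, hext⟩ := id h
  have hex : ∀ m : w.valueMonoid, ∃ (n : ℕ+) (γ : valueGroup v), (n : ℕ) • (m : M) = ι γ :=
    fun m => he.exists_nsmul_eq_of_mem_valueMonoid hι hext hw m.2
  choose n γ hn using hex
  have hle : ∀ (m m' : w.valueMonoid) (k k' : ℕ+) (δ δ' : valueGroup v),
      (k : ℕ) • (m : M) = ι δ → (k' : ℕ) • (m' : M) = ι δ' → m ≤ m' →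
      DivisibleHull.mk (δ : Γ) k ≤ DivisibleHull.mk (δ' : Γ) k' := by
    intro m m' k k' δ δ' hk hk' hmm
    rw [DivisibleHull.mk_le_mk]
    suffices (k' : ℕ) • δ ≤ (k : ℕ) • δ' by exact_mod_cast this
    rw [← hι.le_iff_le, map_nsmul, map_nsmul, ← hk, ← hk', smul_comm]
    exact nsmul_le_nsmul_right (nsmul_le_nsmul_right hmm _) _
  have huniq : ∀ (m : w.valueMonoid) (k : ℕ+) (δ : valueGroup v), (k : ℕ) • (m : M) = ι δ →
      DivisibleHull.mk (γ m : Γ) (n m) = DivisibleHull.mk (δ : Γ) k := fun m k δ hk =>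
    le_antisymm (hle m m _ _ _ _ (hn m) hk le_rfl) (hle m m _ _ _ _ hk (hn m) le_rfl)
  let φ : w.valueMonoid →+ DivisibleHull Γ :=
    { toFun := fun m => DivisibleHull.mk (γ m : Γ) (n m)
      map_zero' := by rw [huniq 0 1 0 (by simp)]; simp
      map_add' := fun m m' => by
        rw [DivisibleHull.mk_add_mk]
        refine huniq (m + m') _ ((n m' : ℕ) • γ m + (n m : ℕ) • γ m') ?_
        rw [ι.map_add, map_nsmul, map_nsmul, ← hn, ← hn, PNat.mul_coe, AddSubmonoid.coe_add,
          nsmul_add, mul_smul, smul_comm, mul_smul] }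
  have hmono : Monotone φ := fun m m' hmm => hle m m' _ _ _ _ (hn m) (hn m') hmm
  have hpos : ∀ m : w.valueMonoid, φ m = 0 → m = 0 := by
    intro m hm
    have h1 : γ m = 0 := by
      have h2 : DivisibleHull.mk (γ m : Γ) (n m) = DivisibleHull.mk 0 1 :=
        hm.trans (DivisibleHull.mk_zero 1).symm
      rw [DivisibleHull.mk_eq_mk_iff_smul_eq_smul] at h2
      simpa using h2
    have h3 := hn m
    rw [h1, ι.map_zero] at h3
    rcases lt_trichotomy (m : M) 0 with h | h | h
    · exact ((nsmul_neg_iff (n m).ne_zero).2 h).ne h3 |>.elim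
    · exact Subtype.ext h
    · exact ((nsmul_pos_iff (n m).ne_zero).2 h).ne' h3 |>.elim
  -- A positive multiple of `m` is invertible, hence so is `m`. The value monoid is thus a group,
  -- and a trivial kernel gives injectivity.
  have hneg : ∀ m : w.valueMonoid, ∃ k : w.valueMonoid, k + m = 0 := by
    intro m
    obtain ⟨k, hk⟩ := Nat.exists_eq_succ_of_ne_zero (n m).ne_zero
    refine ⟨⟨ι (-γ m), Extends.map_mem_valueMonoid hext _⟩ + k • m, Subtype.ext ?_⟩
    rw [add_assoc, ← succ_nsmul, ← Nat.succ_eq_add_one, ← hk, AddSubmonoid.coe_add,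
      AddSubmonoidClass.coe_nsmul, hn, ← ι.map_add, neg_add_cancel, ι.map_zero]
    rfl
  have hinj : Function.Injective φ := by
    intro m m' hmm
    obtain ⟨k, hk⟩ := hneg m
    have h1 : k + m' = 0 := hpos _ (by rw [map_add, ← hmm, ← map_add, hk, map_zero])
    calc m = k + m' + m := by rw [h1, zero_add]
      _ = k + m + m' := by abel
      _ = m' := by rw [hk, zero_add]
  have hval : ∀ (x : E) (hx : x ≠ 0) (m : M) (hm : w x = m),
      w' x = (φ ⟨m, coe_mem_valueMonoid hx hm⟩ : WithTop (DivisibleHull Γ)) :=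
    fun x hx m hm => he.map_eq_mk hι hext he' hw' hring hx (Algebra.IsIntegral.isIntegral x) hm
      (hn ⟨m, _⟩)
  have hrange : AddMonoidHom.mrange φ = w'.valueMonoid := by
    apply le_antisymm
    · rintro _ ⟨⟨m, hm⟩, rfl⟩
      induction hm using AddSubmonoid.closure_induction with
      | mem m hm =>
        obtain ⟨x, hx, hxm⟩ := hm
        exact coe_mem_valueMonoid hx (hval x hx m hxm)
      | zero => exact (map_zero φ).symm ▸ zero_mem _
      | add m m' hm hm' h h' =>
        have : φ ⟨m + m', add_mem hm hm'⟩ = φ ⟨m, hm⟩ + φ ⟨m', hm'⟩ := map_add φ ⟨m, hm⟩ ⟨m', hm'⟩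
        exact this ▸ add_mem h h'
    · rw [valueMonoid, AddSubmonoid.closure_le]
      rintro q ⟨x, hx, hxq⟩
      obtain ⟨m, hm⟩ := WithTop.ne_top_iff_exists.1 (h.map_ne_top hx)
      refine ⟨⟨m, coe_mem_valueMonoid hx hm.symm⟩, ?_⟩
      rw [hval x hx m hm.symm, WithTop.coe_inj] at hxq
      exact hxq
  have hcod : ∀ m, φ m ∈ w'.valueMonoid := fun m => hrange ▸ ⟨m, rfl⟩
  have hbij : Function.Bijective (φ.codRestrict w'.valueMonoid hcod) := by
    refine ⟨fun m m' hmm => hinj (congrArg Subtype.val hmm), ?_⟩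
    rintro ⟨q, hq⟩
    rw [← hrange] at hq
    obtain ⟨m, rfl⟩ := hq
    exact ⟨m, rfl⟩
  refine ⟨{ AddEquiv.ofBijective (φ.codRestrict w'.valueMonoid hcod) hbij with
    map_le_map_iff' := fun {m m'} => (hmono.strictMono_of_injective hinj).le_iff_le }, ?_⟩
  intro x m
  change w x = _ ↔ w' x = ((φ m : DivisibleHull Γ) : WithTop (DivisibleHull Γ))
  by_cases hx : x = 0
  · simp [hx, w.map_zero', w'.map_zero']
  · obtain ⟨m₀, hm₀⟩ := WithTop.ne_top_iff_exists.1 (h.map_ne_top hx)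
    have hwx := hm₀.symm
    rw [hval x hx m₀ hwx, WithTop.coe_inj, hinj.eq_iff, ← hm₀, WithTop.coe_inj]
    exact ⟨fun h => Subtype.ext h, fun h => congrArg Subtype.val h⟩

end QuasiValuation

/-! ### The correspondence with integrally closed rings -/

/-- Every integrally closed quasi-valuation ring is the ring of the minimum of finitely many
valuations, and this is the only exponential quasi-valuation with that ring. -/
theorem exists_minimum_of_mem_integrallyClosedQuasiValuationRings {F : Type uF} {E : Type uE}
    {Γ : Type uΓ} [Field F] [Field E] [Algebra F E] [FiniteDimensional F E] [AddCommGroup Γ]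
    [LinearOrder Γ] [IsOrderedAddMonoid Γ] (v : AddValuation F (WithTop Γ)) {R : Subring E}
    (hR : R ∈ integrallyClosedQuasiValuationRings v E) :
    ∃ (U : Finset (AddValuation E (WithTop (DivisibleHull Γ)))) (hU : U.Nonempty),
      (∀ u ∈ U, ∀ a : F,
        u (algebraMap F E a) = (v a).map (fun γ : Γ => (γ : DivisibleHull Γ))) ∧
      (∀ x : E, x ∈ R ↔ ∀ u ∈ U, 0 ≤ u x) ∧
      ∃ (w : QuasiValuation E (DivisibleHull Γ)) (hw : w.Extends v),
        IsWeaklyCancellative w.valueMonoid ∧ w.IsExponential ∧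
        (∀ x : E, w x = U.inf' hU (fun u => u x)) ∧
        w.ring hw = R ∧
        ∀ W : ExpQuasiValuationExt v E, W.w.ring W.extends_v = R → W.w.Equivalent w := by
  obtain ⟨hic, W, rfl⟩ := hR
  obtain ⟨U, hU, hUF, hmem⟩ := W.extends_v.exists_finset_addValuation W.weaklyCancellative
  have hF : ∀ a : F, QuasiValuation.minimum U hU (algebraMap F E a) =
      (v a).map (fun γ : Γ => (γ : DivisibleHull Γ)) := by
    intro a
    rw [QuasiValuation.minimum_apply, Finset.inf'_congr hU rfl fun u hu => hUF u hu a,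
      Finset.inf'_const]
  have hring : ∀ x, 0 ≤ QuasiValuation.minimum U hU x ↔ x ∈ W.w.ring W.extends_v := by
    intro x
    rw [hmem, QuasiValuation.minimum_apply, Finset.le_inf'_iff]
  refine ⟨U, hU, hUF, hmem, QuasiValuation.minimum U hU, QuasiValuation.extends_of_map_coe hF,
    QuasiValuation.isWeaklyCancellative_valueMonoid _, QuasiValuation.isExponential_minimum U hU,
    fun x => rfl, Subring.ext hring, fun W' hW' => ?_⟩
  refine W'.exponential.equivalent_of_ring_eq W'.extends_v W'.weaklyCancellative
    (QuasiValuation.isExponential_minimum U hU) hF fun x => ?_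
  rw [hring, ← hW']
  rfl

theorem corollary7p8 {F : Type uF} {E : Type uE} {Γ : Type uΓ} [Field F] [Field E] [Algebra F E]
    [FiniteDimensional F E] [AddCommGroup Γ] [LinearOrder Γ] [IsOrderedAddMonoid Γ]
    (v : AddValuation F (WithTop Γ)) :
    Set.BijOn (quasiValuationRingMap v E) Set.univ (integrallyClosedQuasiValuationRings v E) ∧
    ∀ R ∈ integrallyClosedQuasiValuationRings v E,
      ∃ (U : Finset (AddValuation E (WithTop (DivisibleHull Γ)))) (hU : U.Nonempty),
        (∀ u ∈ U, ∀ a : F,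
          u (algebraMap F E a) = (v a).map (fun γ : Γ => (γ : DivisibleHull Γ))) ∧
        (∀ x : E, x ∈ R ↔ ∀ u ∈ U, 0 ≤ u x) ∧
        ∃ (w : QuasiValuation E (DivisibleHull Γ)) (hw : w.Extends v),
          IsWeaklyCancellative w.valueMonoid ∧ w.IsExponential ∧
          (∀ x : E, w x = U.inf' hU (fun u => u x)) ∧
          w.ring hw = R ∧
          ∀ W : ExpQuasiValuationExt v E, W.w.ring W.extends_v = R → W.w.Equivalent w := by
  have hmaps : ∀ W : ExpQuasiValuationExt v E,
      W.w.ring W.extends_v ∈ integrallyClosedQuasiValuationRings v E := fun W =>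
    ⟨QuasiValuation.IsExponential.isIntegrallyClosedIn W.extends_v W.weaklyCancellative
      W.exponential, W.toQuasiValuationExt, rfl⟩
  refine ⟨⟨?_, ?_, ?_⟩, fun R hR =>
    exists_minimum_of_mem_integrallyClosedQuasiValuationRings v hR⟩
  · rintro ⟨W⟩ -
    exact hmaps W
  · rintro ⟨W⟩ - ⟨W'⟩ - h
    obtain ⟨U, hU, -, -, w, hw, hwc, hwe, -, -, huniq⟩ :=
      exists_minimum_of_mem_integrallyClosedQuasiValuationRings v (hmaps W)
    -- The minimum has values in the same universe as `Γ`, so it represents a class itself; `W` and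
    -- `W'` are both compared with it.
    let W₀ : ExpQuasiValuationExt v E :=
      { M := DivisibleHull Γ
        w := w
        extends_v := hw
        weaklyCancellative := hwc
        exponential := hwe }
    have h1 : (ExpQuasiValuationExt.setoid v E).r W W₀ := huniq W rfl
    have h2 : (ExpQuasiValuationExt.setoid v E).r W' W₀ := huniq W' h.symm
    exact Quotient.sound ((ExpQuasiValuationExt.setoid v E).trans h1
      ((ExpQuasiValuationExt.setoid v E).symm h2))
  · intro R hR
    obtain ⟨U, hU, -, -, w, hw, hwc, hwe, -, hring, -⟩ :=
      exists_minimum_of_mem_integrallyClosedQuasiValuationRings v hR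
    exact ⟨Quotient.mk _
      { M := DivisibleHull Γ
        w := w
        extends_v := hw
        weaklyCancellative := hwc
        exponential := hwe }, Set.mem_univ _, hring⟩
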